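/- Let $G$ be a (not necessarily finite) group, let $m\ge 0$, and let $F(x_1,\dots,x_m)$ be the free group on unknowns $x_1,\dots,x_m$. Let $S=\{u_i(x_1,\dots,x_m)\in H_ig_iH_i \mid i\in I\}$ be a (not necessarily finite) system of generalised equations over $G$, where $g_i\in G$, the $H_i$ are subgroups of $G$, and each $u_i\in G*F(x_1,\dots,x_m)$ is given by a word in the alphabet $G\sqcup\{x_1^{\pm1},\dots,x_m^{\pm1}\}$; the elements of $G$ occurring in the words $u_i$ are called the coefficients of $S$. Let $J\subseteq I$ and let $P=\{u_j(x_1,\dots,x_m)\in H_jg_jH_j\mid j\in J\}$ be the corresponding subsystem. Put $$\tilde H=\Bigl(\bigcap_{j\in J}N(H_jg_jH_j)\Bigr)\cap\Bigl(\bigcap_{i\in I\setminus J}H_i\Bigr)\cap C,$$ where $N(A)=\{g\in G\mid g^{-1}Ag=A\}$ for a subset $A\subseteq G$, and $C$ is the centraliser in $G$ of the set of all coefficients of $S$. Let $\Delta_k\ge 0$ be the greatest common divisor of all minors of order $k$ of the matrix of $P$, that is, of the integer matrix $(a_{jl})_{j\in J,\,1\le l\le m}$ in which $a_{jl}$ is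 the exponent sum of $x_l$ in $u_j$; here $\Delta_0=1$, $\Delta_k=0$ if $k$ exceeds the number of equations of $P$, $\frac00=0$, and the ratio $\Delta_m/\Delta_{m-1}$ is read as $1$ if $m=0$. Then the number of solutions $(x_1,\dots,x_m)\in G^m$ of $S$ is divisible by $\mathrm{GCD}\bigl(\tilde H,\Delta_m/\Delta_{m-1}\bigr)$. Here, for a group $K$ and an integer $n$, $\mathrm{GCD}(K,n)$ is the least common multiple of the orders of those subgroups of $K$ whose orders divide $n$. Orders, numbers of solutions and divisibility are understood in the sense of cardinal arithmetic: an infinite cardinal is divisible by all nonzero cardinals not exceeding it, and zero is divisible by all cardinals and divides only zero; the least common multiple of a family of nonzero cardinals is the least nonzero cardinal divisible by all of them, so that $\mathrm{GCD}(K,0)=|K|$. -/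

import Mathlib

namespace GroupEquations

/-- A word in the alphabet `G ⊔ {x₁^{±1}, …, x_m^{±1}}`. The letter `Sum.inl a` is the coefficient
`a`, the letter `Sum.inr (j, true)` is `x_j` and the letter `Sum.inr (j, false)` is `x_j⁻¹`. -/
abbrev Word (G : Type*) (m : ℕ) : Type _ := List (G ⊕ (Fin m × Bool))

section Words

variable {G : Type*} [Group G] {m : ℕ}

/-- The element of the free product `G * F(x₁, …, x_m)` given by a single letter. -/
def letter : G ⊕ (Fin m × Bool) → Monoid.Coprod G (FreeGroup (Fin m))
  | Sum.inl a => Monoid.Coprod.inl a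
  | Sum.inr (j, true) => Monoid.Coprod.inr (FreeGroup.of j)
  | Sum.inr (j, false) => Monoid.Coprod.inr (FreeGroup.of j)⁻¹

/-- The element of the free product `G * F(x₁, …, x_m)` represented by a word. -/
def Word.toCoprod (w : Word G m) : Monoid.Coprod G (FreeGroup (Fin m)) :=
  (w.map letter).prod

/-- The coefficients of a word: the elements of `G` occurring in it. -/
def Word.coeffs (w : Word G m) : Set G := {a | Sum.inl a ∈ w}

/-- The value `u(x₁, …, x_m)` in `G` of an element `u` of the free product at a tuple of elements
of `G`: the homomorphism that is the identity on `G` and sends the `j`-th unknown to `x j`. -/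
def evalAt (x : Fin m → G) : Monoid.Coprod G (FreeGroup (Fin m)) →* G :=
  Monoid.Coprod.lift (MonoidHom.id G) (FreeGroup.lift x)

/-- The exponent sum of the `j`-th unknown in an element of the free product: the homomorphism
to `ℤ` that vanishes on `G`, sends the `j`-th unknown to `1` and the other unknowns to `0`. -/
def expSum (j : Fin m) (u : Monoid.Coprod G (FreeGroup (Fin m))) : ℤ :=
  Multiplicative.toAdd
    (Monoid.Coprod.lift (1 : G →* Multiplicative ℤ)
      (FreeGroup.lift fun k => Multiplicative.ofAdd (if k = j then (1 : ℤ) else 0)) u)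

/-- The set of solutions in `G` of the system of generalised equations
`w i (x₁, …, x_m) ∈ H i * g i * H i`, where `i` runs over `I`. -/
def solutions {I : Type*} (w : I → Word G m) (g : I → G) (H : I → Subgroup G) :
    Set (Fin m → G) :=
  {x | ∀ i, evalAt x (w i).toCoprod ∈ DoubleCoset.doubleCoset (g i) (H i : Set G) (H i : Set G)}

/-- The matrix of a system: its `(i, j)` entry is the exponent sum of the `j`-th unknown in the
left-hand side of the `i`-th equation. -/
def systemMatrix {I : Type*} (w : I → Word G m) : Matrix I (Fin m) ℤ :=
  Matrix.of fun i j => expSum j (w i).toCoprod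

/-- The subgroup `H̃` attached to a system indexed by `I` and its subsystem indexed by `J`: the
intersection of the normalisers of the double cosets of the subsystem, of the subgroups `H i` for
the other equations, and of the centraliser of the set of coefficients of the whole system. -/
def tildeH {I : Type*} (w : I → Word G m) (g : I → G) (H : I → Subgroup G) (J : Set I) :
    Subgroup G :=
  (⨅ j ∈ J,
      Subgroup.normalizer (DoubleCoset.doubleCoset (g j) (H j : Set G) (H j : Set G))) ⊓
    (⨅ i ∈ Jᶜ, H i) ⊓
    Subgroup.centralizer (⋃ i, (w i).coeffs)

end Words

/-- The set of minors of order `k` of a matrix, which may have infinitely many rows. -/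
def minors {ι : Type*} {m : ℕ} (A : Matrix ι (Fin m) ℤ) (k : ℕ) : Set ℤ :=
  {d | ∃ (r : Fin k ↪ ι) (c : Fin k ↪ Fin m), d = (A.submatrix r c).det}

/-- `Δ_k`: the nonnegative greatest common divisor of all minors of order `k`, that is, the
nonnegative generator of the ideal of `ℤ` spanned by them. In particular `Δ_0 = 1`, and
`Δ_k = 0` if there are no minors of order `k`. -/
noncomputable def Delta {ι : Type*} {m : ℕ} (A : Matrix ι (Fin m) ℤ) (k : ℕ) : ℕ :=
  (Submodule.IsPrincipal.generator (Ideal.span (minors A k))).natAbs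

/-- The ratio `Δ_m / Δ_{m-1}`, where `m` is the number of columns and `0 / 0 = 0`. Each `Δ_{m-1}`
divides `Δ_m`, so the division in `ℕ` is exact. For `m = 0` the value is `1`. -/
noncomputable def deltaRatio {ι : Type*} {m : ℕ} (A : Matrix ι (Fin m) ℤ) : ℕ :=
  Delta A m / Delta A (m - 1)

/-- `GCD(K, n)` for a group `K` and an integer `n ≥ 0`: the least common multiple of the orders of
the subgroups of `K` whose order divides `n`, that is, the least nonzero cardinal divisible by all
these orders. Orders and divisibility are those of cardinal arithmetic. -/
noncomputable def groupGCD (K : Type*) [Group K] (n : ℕ) : Cardinal :=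
  sInf {c : Cardinal | c ≠ 0 ∧
    ∀ L : Subgroup K, Cardinal.mk L ∣ (n : Cardinal) → Cardinal.mk L ∣ c}

end GroupEquations

/-! It suffices that |L| divides the number of solutions for every L ≤ H̃ whose order divides n =
Δ_m/Δ_{m-1} (`groupGCD_dvd`). For m > 0, cofactor vectors yield a primitive integer vector d that
the matrix of P kills modulo n (`exists_primitive`). Let K be the centraliser of L, which contains
all coefficients. Giving x_l degree d_l and K degree 0 maps K * F onto ℤ, and the left-hand sides of
P get degrees divisible by |L|.

Solutions are certain homomorphisms φ : K * F → G fixing K. They are permuted by conjugation by L,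
and also by twists: keep φ on the kernel of the degree and multiply its value at an element of
degree 1 by an element of a subgroup U ≤ L, the core of φ. For equations of P, Brauer's lemma shows
that a twist replaces the value by an L-conjugate (`IsTwist.exists_conj`); for the others, the value
acquires a factor from L ≤ H_i. The classes under both operations have |L/U|·|U| = |L| elements each
(`mk_dvd_mk_of_closed`). -/

namespace GroupEquations

/-! ### Cardinal arithmetic of the GCD. -/

/-- If `c` is a nonzero cardinal divisible by the orders of all subgroups of `K` whose order divides
`n`, then it is divisible by `GCD(K, n)`. -/
theorem groupGCD_dvd {K : Type*} [Group K] {n : ℕ} {c : Cardinal}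
    (h : ∀ L : Subgroup K, Cardinal.mk L ∣ (n : Cardinal) → Cardinal.mk L ∣ c) :
    groupGCD K n ∣ c := by
  rcases eq_or_ne c 0 with rfl | hc
  · exact dvd_zero _
  set S : Set Cardinal := {c : Cardinal | c ≠ 0 ∧
    ∀ L : Subgroup K, Cardinal.mk L ∣ (n : Cardinal) → Cardinal.mk L ∣ c}
  have hcS : c ∈ S := ⟨hc, h⟩
  have hmem : sInf S ∈ S := csInf_mem ⟨c, hcS⟩
  have hle : sInf S ≤ c := csInf_le' hcS
  change sInf S ∣ c
  rcases lt_or_ge c Cardinal.aleph0 with hfin | hinf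
  · obtain ⟨a, ha⟩ := Cardinal.lt_aleph0.1 (hle.trans_lt hfin)
    obtain ⟨b, rfl⟩ := Cardinal.lt_aleph0.1 hfin
    have hb : b ≠ 0 := by simpa using hc
    rw [ha] at hmem ⊢
    have ha0 : a ≠ 0 := by simpa using hmem.1
    -- The gcd of the minimum with `c` is again a common multiple, so by minimality it equals the
    -- minimum.
    have hg : ((a.gcd b : ℕ) : Cardinal) ∈ S := by
      refine ⟨by simpa using fun h => absurd h ha0, fun L hL => ?_⟩
      have h1 := hmem.2 L hL
      have h2 := h L hL
      have hlt : Cardinal.mk L < Cardinal.aleph0 :=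
        (Cardinal.le_of_dvd (by simpa using hb) h2).trans_lt hfin
      obtain ⟨l, hl⟩ := Cardinal.lt_aleph0.1 hlt
      rw [hl] at h1 h2 ⊢
      rw [Cardinal.nat_coe_dvd_iff] at h1 h2 ⊢
      exact Nat.dvd_gcd h1 h2
    have h3 : sInf S ≤ ((a.gcd b : ℕ) : Cardinal) := csInf_le' hg
    rw [ha, Nat.cast_le] at h3
    have h4 : a.gcd b = a := le_antisymm (Nat.gcd_le_left _ (Nat.pos_of_ne_zero ha0)) h3
    rw [Cardinal.nat_coe_dvd_iff]
    exact Nat.gcd_eq_left_iff_dvd.1 h4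
  · exact Cardinal.dvd_of_le_of_aleph0_le hmem.1 hle hinf

/-! ### Brauer's lemma. -/

section Brauer

variable {G : Type*} [Group G]

/-- **Brauer's lemma**: if `v` normalises a subgroup `U` and `u ∈ U`, then `v ^ |U|` and
`(v * u) ^ |U|` are conjugate by an element of `U`. -/
theorem exists_mul_pow_card_eq_conj (U : Subgroup G) (v u : G)
    (hv : ∀ a ∈ U, v * a * v⁻¹ ∈ U) (hu : u ∈ U) :
    ∃ a ∈ U, (v * u) ^ Nat.card U = a * v ^ Nat.card U * a⁻¹ := by
  classical
  rcases finite_or_infinite U with hfin | hinf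
  swap
  -- Here `Nat.card U = 0`, so both powers are 1.
  · exact ⟨1, U.one_mem, by simp⟩
  set w := v * u with hw
  have hσ : ∀ a ∈ U, w * a * v⁻¹ ∈ U := fun a ha => by
    have := hv _ (U.mul_mem hu ha)
    simpa [hw, mul_assoc] using this
  -- A fixed point `a` of `s^[k]` means w^k = a v^k a⁻¹, so it is enough to find such a `k` dividing
  -- |U|.
  let s : U → U := fun a => ⟨w * a * v⁻¹, hσ a a.2⟩
  have hs : ∀ (k : ℕ) (a : U), ((s^[k] a : U) : G) = w ^ k * a * (v ^ k)⁻¹ := by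
    intro k
    induction k with
    | zero => simp
    | succ k ih =>
      intro a
      rw [Function.iterate_succ_apply',
        show ((s (s^[k] a) : U) : G) = w * (s^[k] a : U) * v⁻¹ from rfl,
        ih, pow_succ' w, pow_succ v]
      group
  have hinj : Function.Injective s := fun a b hab => by
    have : w * a * v⁻¹ = w * b * v⁻¹ := congrArg Subtype.val hab
    exact Subtype.ext (by simpa using this)
  have hex : ∃ k, 0 < k ∧ ∃ a, s^[k] a = a := by
    have h1 := hinj.mem_periodicPts 1
    obtain ⟨k, hk, hk'⟩ := h1
    exact ⟨k, hk, 1, hk'⟩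
  -- The length of a shortest cycle of `s`. All cycles inside the fixed set `X` of `s^[k]` then have
  -- length exactly `k`, so `k` divides |X|.
  set k := Nat.find hex
  obtain ⟨hk, a₀, ha₀⟩ : 0 < k ∧ ∃ a, s^[k] a = a := Nat.find_spec hex
  have hmin : ∀ j, 0 < j → ∀ a, s^[j] a = a → k ≤ j := fun j hj a ha =>
    Nat.find_min' hex ⟨hj, a, ha⟩
  let X := {a : U // s^[k] a = a}
  let τ : X → X := fun a => ⟨s a.1, by
    rw [← Function.iterate_succ_apply, Function.iterate_succ_apply', a.2]⟩
  have hτ : ∀ (j : ℕ) (a : X), (τ^[j] a).1 = s^[j] a.1 := by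
    intro j
    induction j with
    | zero => intro a; rfl
    | succ j ih => intro a; rw [Function.iterate_succ_apply', Function.iterate_succ_apply', ← ih]
  have hτk : ∀ a, τ^[k] a = a := fun a => Subtype.ext ((hτ k a).trans a.2)
  have hτinj : Function.Injective τ := fun a b hab =>
    Subtype.ext (hinj (congrArg Subtype.val hab))
  let π : Equiv.Perm X := Equiv.ofBijective τ (Finite.injective_iff_bijective.1 hτinj)
  have hπ : ∀ (j : ℕ) a, (π ^ j) a = τ^[j] a := fun j a => by
    rw [Equiv.Perm.coe_pow]; rfl
  have hπk : π ^ k = 1 := Equiv.ext fun a => by rw [hπ, hτk]; rfl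
  have hfree : ∀ (g : Subgroup.zpowers π) (a : X), g • a = a → g = 1 := by
    rintro ⟨g, hg⟩ a ha
    obtain ⟨j, hj⟩ := (isOfFinOrder_iff_pow_eq_one.2 ⟨k, hk, hπk⟩).mem_powers_iff_mem_zpowers.2 hg
    have hj' : g = π ^ (j % k) := by
      rw [← hj]; simp only
      conv_lhs => rw [← Nat.mod_add_div j k, pow_add, pow_mul, hπk, one_pow, mul_one]
    have h1 : (π ^ (j % k)) a = a := by rw [← hj']; exact ha
    rw [hπ] at h1
    rcases Nat.eq_zero_or_pos (j % k) with h0 | h0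
    · exact Subtype.ext (by simpa [h0] using hj')
    · have := hmin _ h0 a.1 (by rw [← hτ, h1])
      exact absurd (Nat.mod_lt j hk) (not_lt.2 this)
  have hord : orderOf π = k := by
    refine le_antisymm (orderOf_le_of_pow_eq_one hk hπk) ?_
    have h1 : π ^ orderOf π = 1 := pow_orderOf_eq_one π
    have h2 : (π ^ orderOf π) ⟨a₀, ha₀⟩ = ⟨a₀, ha₀⟩ := by rw [h1]; rfl
    rw [hπ] at h2
    refine hmin _ (orderOf_pos_iff.2 (isOfFinOrder_iff_pow_eq_one.2 ⟨k, hk, hπk⟩)) a₀ ?_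
    have := congrArg Subtype.val h2
    rwa [hτ] at this
  have hdvdX : k ∣ Nat.card X := by
    have e := MulAction.selfEquivOrbitsQuotientProd (G := Subgroup.zpowers π) (X := X)
      (fun a => by
        rw [Subgroup.eq_bot_iff_forall]
        exact fun g hg => hfree g a hg)
    rw [Nat.card_congr e, Nat.card_prod, Nat.card_zpowers, hord]
    exact dvd_mul_left _ _
  have hfix : ∀ a : U, s^[k] a = a ↔ w ^ k * a = a * v ^ k := fun a => by
    rw [Subtype.ext_iff, hs, mul_inv_eq_iff_eq_mul]
  -- `X` is the left coset a₀D, hence `k` divides |D| and therefore |U|.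
  let D : Subgroup U := (Subgroup.centralizer {v ^ k}).subgroupOf U
  have hD : ∀ b : U, b ∈ D ↔ (b : G) * v ^ k = v ^ k * b := fun b => by
    simp only [D, Subgroup.mem_subgroupOf, Subgroup.mem_centralizer_singleton_iff]
  have hcard : Nat.card X = Nat.card D := by
    refine Nat.card_congr (Equiv.subtypeEquiv (Equiv.mulLeft a₀⁻¹) fun a => ?_)
    have h0 := (hfix a₀).1 ha₀
    rw [hfix]
    change _ ↔ a₀⁻¹ * a ∈ D
    rw [hD]
    push_cast
    have h1 : w ^ k = a₀ * v ^ k * (a₀ : G)⁻¹ := by rw [← h0]; group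
    rw [h1]
    constructor
    · intro h
      rw [mul_assoc, ← h]; group
    · intro h
      have : (a₀ : G) * (((a₀ : G)⁻¹ * a) * v ^ k) = a₀ * (v ^ k * ((a₀ : G)⁻¹ * a)) := by rw [h]
      simpa [mul_assoc] using this.symm
  have hdvd : k ∣ Nat.card U := (hcard ▸ hdvdX).trans (Subgroup.card_subgroup_dvd_card D)
  obtain ⟨q, hq⟩ := hdvd
  refine ⟨a₀, a₀.2, ?_⟩
  have h1 : w ^ k = a₀ * v ^ k * (a₀ : G)⁻¹ := by rw [← (hfix a₀).1 ha₀]; group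
  rw [hq, pow_mul, pow_mul, h1, conj_pow]

end Brauer

/-! ### Determinantal divisors and primitive vectors. -/

section Delta

variable {ι : Type*} {m : ℕ}

theorem natCast_dvd_delta_iff (A : Matrix ι (Fin m) ℤ) (k : ℕ) (z : ℤ) :
    z ∣ (Delta A k : ℤ) ↔ ∀ d ∈ minors A k, z ∣ d := by
  rw [Delta, Int.dvd_natAbs, ← Ideal.mem_span_singleton, ← Ideal.span_singleton_le_iff_mem,
    Ideal.span_singleton_generator, Ideal.span_le]
  exact forall₂_congr fun d _ => Ideal.mem_span_singleton

theorem delta_dvd (A : Matrix ι (Fin m) ℤ) {k : ℕ} {d : ℤ} (hd : d ∈ minors A k) :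
    (Delta A k : ℤ) ∣ d :=
  (natCast_dvd_delta_iff A k _).1 dvd_rfl d hd

theorem delta_zero (A : Matrix ι (Fin m) ℤ) : Delta A 0 = 1 := by
  have h : (Delta A 0 : ℤ) ∣ 1 :=
    delta_dvd A ⟨⟨Fin.elim0, fun i => i.elim0⟩, ⟨Fin.elim0, fun i => i.elim0⟩, by simp⟩
  exact Nat.dvd_one.1 (by exact_mod_cast h)

/-- The determinant of a submatrix given by arbitrary families of rows and columns is divisible by
the greatest common divisor of the minors. -/
theorem delta_dvd_det_submatrix (A : Matrix ι (Fin m) ℤ) {k : ℕ} (r : Fin k → ι)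
    (c : Fin k → Fin m) : (Delta A k : ℤ) ∣ (A.submatrix r c).det := by
  by_cases hr : Function.Injective r
  · by_cases hc : Function.Injective c
    · exact delta_dvd A ⟨⟨r, hr⟩, ⟨c, hc⟩, rfl⟩
    · obtain ⟨i, j, hij, hne⟩ := Function.not_injective_iff.1 hc
      rw [Matrix.det_zero_of_column_eq hne fun l => by simp [hij]]
      exact dvd_zero _
  · obtain ⟨i, j, hij, hne⟩ := Function.not_injective_iff.1 hr
    rw [Matrix.det_zero_of_row_eq hne (by ext l; simp [hij])]
    exact dvd_zero _

theorem delta_dvd_delta_succ (A : Matrix ι (Fin m) ℤ) (k : ℕ) : Delta A k ∣ Delta A (k + 1) := by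
  rw [← Int.natCast_dvd_natCast, natCast_dvd_delta_iff]
  rintro d ⟨r, c, rfl⟩
  rw [Matrix.det_succ_row_zero]
  refine Finset.dvd_sum fun j _ => Dvd.dvd.mul_left ?_ _
  rw [Matrix.submatrix_submatrix]
  exact delta_dvd_det_submatrix A _ _

/-- The vector of signed complementary minors of `k` rows and `k + 1` columns. -/
def cofactorVec (A : Matrix ι (Fin m) ℤ) {k : ℕ} (r : Fin k → ι) (c : Fin (k + 1) → Fin m) :
    Fin m → ℤ :=
  ∑ j, Pi.single (c j) ((-1) ^ (j : ℕ) * (A.submatrix r (c ∘ j.succAbove)).det)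

theorem cofactorVec_apply (A : Matrix ι (Fin m) ℤ) {k : ℕ} (r : Fin k → ι)
    {c : Fin (k + 1) → Fin m} (hc : Function.Injective c) (j : Fin (k + 1)) :
    cofactorVec A r c (c j) = (-1) ^ (j : ℕ) * (A.submatrix r (c ∘ j.succAbove)).det := by
  rw [cofactorVec, Finset.sum_apply, Finset.sum_eq_single j]
  · simp
  · intro i _ hij
    exact Pi.single_eq_of_ne (fun h => hij (hc h).symm) _
  · simp

/-- Laplace expansion along the prepended row. Thus the vector consists of minors of order k and
zeros, while its image under `A` is divisible by Δ_{k+1}. -/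
theorem sum_mul_cofactorVec (A : Matrix ι (Fin m) ℤ) {k : ℕ} (r : Fin k → ι)
    (c : Fin (k + 1) → Fin m) (i : ι) :
    ∑ l, A i l * cofactorVec A r c l = (A.submatrix (Fin.cons i r : Fin (k + 1) → ι) c).det := by
  rw [Matrix.det_succ_row_zero]
  simp only [cofactorVec, Finset.sum_apply, Finset.mul_sum]
  rw [Finset.sum_comm]
  refine Finset.sum_congr rfl fun j _ => ?_
  rw [Finset.sum_eq_single (c j)]
  · simp only [Pi.single_eq_same, Matrix.submatrix_apply, Fin.cons_zero, Matrix.submatrix_submatrix]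
    rw [show (Fin.cons i r : Fin (k + 1) → ι) ∘ Fin.succ = r from by ext x; simp]
    ring
  · intro l _ hl
    rw [Pi.single_eq_of_ne hl, mul_zero]
  · simp

/-- An injection of `Fin k` into `Fin (k + 1)` is, up to a permutation, the one that skips some
element. -/
theorem exists_perm_succAbove {k : ℕ} (c : Fin k ↪ Fin (k + 1)) :
    ∃ (l : Fin (k + 1)) (σ : Equiv.Perm (Fin k)), (c : Fin k → Fin (k + 1)) = l.succAbove ∘ σ := by
  obtain ⟨l, hl⟩ : ∃ l, l ∉ Set.range c := by
    by_contra h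
    push Not at h
    have := Fintype.card_le_of_surjective c h
    simp at this
  have h1 : ∀ i, ∃ j, l.succAbove j = c i := fun i =>
    Fin.exists_succAbove_eq fun h => hl ⟨i, h⟩
  choose f hf using h1
  have hinj : Function.Injective f := fun i j hij => c.injective (by rw [← hf, ← hf, hij])
  exact ⟨l, Equiv.ofBijective f (Finite.injective_iff_bijective.1 hinj),
    funext fun i => (hf i).symm⟩

/-- A vector annihilated modulo `n` whose content is prime to `n` can be divided by its content,
which gives a primitive vector annihilated modulo `n`. -/
theorem exists_primitive_of_gcd {n : ℕ} (A : Matrix ι (Fin m) ℤ) (x : Fin m → ℤ) (hx : x ≠ 0)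
    (hcop : ∀ p : ℕ, p.Prime → p ∣ n → n ≠ 0 → ∃ l, ¬ (p : ℤ) ∣ x l)
    (hA : ∀ i, (n : ℤ) ∣ ∑ l, A i l * x l) :
    ∃ d t : Fin m → ℤ, ∑ l, d l * t l = 1 ∧ ∀ i, (n : ℤ) ∣ ∑ l, A i l * d l := by
  obtain ⟨l₀, hl₀⟩ := Function.ne_iff.1 hx
  obtain ⟨d, hd, hd1⟩ := Finset.extract_gcd x ⟨l₀, Finset.mem_univ _⟩
  set c := Finset.univ.gcd x
  have hc0 : c ≠ 0 := fun h => hl₀ (by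
    simpa using Finset.gcd_eq_zero_iff.1 h l₀ (Finset.mem_univ _))
  have hbez : ∃ t : Fin m → ℤ, ∑ l, d l * t l = 1 := by
    obtain ⟨t, ht⟩ := Finset.gcd_eq_sum_mul Finset.univ d
    exact ⟨t, by rw [← ht, hd1]⟩
  obtain ⟨t, ht⟩ := hbez
  refine ⟨d, t, ht, fun i => ?_⟩
  have h1 : ∑ l, A i l * x l = c * ∑ l, A i l * d l := by
    rw [Finset.mul_sum]
    refine Finset.sum_congr rfl fun l hl => ?_
    rw [hd l hl]; ring
  have h2 := hA i
  rw [h1] at h2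
  -- For n = 0 the congruences are equalities and the nonzero content cancels; for n > 0 it is
  -- invertible modulo n.
  rcases Nat.eq_zero_or_pos n with rfl | hn
  · simpa [hc0] using h2
  · refine IsCoprime.dvd_of_dvd_mul_left ?_ h2
    rw [Int.isCoprime_iff_gcd_eq_one]
    by_contra hne
    obtain ⟨p, hp, hpd⟩ := Nat.exists_prime_and_dvd hne
    have hpn : (p : ℤ) ∣ n := (Int.natCast_dvd_natCast.2 hpd).trans (Int.gcd_dvd_left _ _)
    have hpc : (p : ℤ) ∣ c := (Int.natCast_dvd_natCast.2 hpd).trans (Int.gcd_dvd_right _ _)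
    obtain ⟨l, hl⟩ := hcop p hp (Int.natCast_dvd_natCast.1 hpn) hn.ne'
    exact hl (hpc.trans (Finset.gcd_dvd (Finset.mem_univ l)))

theorem deltaRatio_mul (A : Matrix ι (Fin (m + 1)) ℤ) :
    deltaRatio A * Delta A m = Delta A (m + 1) :=
  Nat.div_mul_cancel (delta_dvd_delta_succ A m)

/-- With k the rank, adjoin a column to a nonzero minor of order k: the cofactor vector has that
minor as an entry, and all minors of order k + 1 vanish. -/
theorem exists_ne_zero_of_delta_eq_zero (A : Matrix ι (Fin m) ℤ) (h : Delta A m = 0) :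
    ∃ x : Fin m → ℤ, x ≠ 0 ∧ ∀ i, ∑ l, A i l * x l = 0 := by
  classical
  have hex : ∃ k, Delta A k = 0 := ⟨m, h⟩
  obtain ⟨k, hk⟩ : ∃ k, Nat.find hex = k + 1 := by
    refine Nat.exists_eq_succ_of_ne_zero fun h0 => ?_
    have := Nat.find_spec hex
    rw [h0, delta_zero] at this
    exact one_ne_zero this
  have hk1 : Delta A (k + 1) = 0 := hk ▸ Nat.find_spec hex
  have hk0 : Delta A k ≠ 0 := Nat.find_min hex (by omega)
  have hkm : k < m := by have := Nat.find_min' hex h; omega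
  have hmin : ∃ d ∈ minors A k, d ≠ 0 := by
    by_contra! hall
    have : (0 : ℤ) ∣ Delta A k := (natCast_dvd_delta_iff A k 0).2 fun d hd => by rw [hall d hd]
    exact hk0 (by simpa using this)
  obtain ⟨d, ⟨r, c, rfl⟩, hd⟩ := hmin
  obtain ⟨l, hl⟩ : ∃ l, l ∉ Set.range c := by
    by_contra! hsurj
    have := Fintype.card_le_of_surjective c hsurj
    simp at this
    omega
  have hc : Function.Injective (Fin.cons l c : Fin (k + 1) → Fin m) :=
    Fin.cons_injective_iff.2 ⟨hl, c.injective⟩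
  refine ⟨cofactorVec A r (Fin.cons l c : Fin (k + 1) → Fin m), fun h0 => hd ?_, fun i => ?_⟩
  · have h1 := cofactorVec_apply A r hc 0
    rw [h0] at h1
    have h2 : (Fin.cons l c : Fin (k + 1) → Fin m) ∘ (0 : Fin (k + 1)).succAbove = c := by
      ext x; simp
    rw [h2] at h1
    simpa using h1.symm
  · rw [sum_mul_cofactorVec]
    have := delta_dvd_det_submatrix A (Fin.cons i r : Fin (k + 1) → ι) (Fin.cons l c)
    rw [hk1] at this
    simpa using this

/-- Some minor of order m is not divisible by pΔ_m. Dividing the cofactor vector of its rows by Δ_m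
leaves an entry prime to p, and turns divisibility by Δ_{m+1} of its image into divisibility by the
ratio. -/
theorem exists_not_dvd_of_prime (A : Matrix ι (Fin (m + 1)) ℤ) (h0 : Delta A m ≠ 0) (p : ℕ)
    (hp : p.Prime) :
    ∃ x : Fin (m + 1) → ℤ, (∃ l, ¬ (p : ℤ) ∣ x l) ∧
      ∀ i, (deltaRatio A : ℤ) ∣ ∑ l, A i l * x l := by
  have hΔ : (Delta A m : ℤ) ≠ 0 := by exact_mod_cast h0
  obtain ⟨d, ⟨r, c, rfl⟩, hd⟩ : ∃ d ∈ minors A m, ¬ (p * Delta A m : ℤ) ∣ d := by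
    by_contra! hall
    have h1 := (natCast_dvd_delta_iff A m _).2 hall
    have h2 : (p : ℤ) ∣ 1 := by
      rw [← mul_dvd_mul_iff_right hΔ]; simpa using h1
    exact hp.one_lt.ne' (Nat.dvd_one.1 (by exact_mod_cast h2))
  obtain ⟨l, σ, hlσ⟩ := exists_perm_succAbove c
  have hdiv : ∀ j, (Delta A m : ℤ) ∣ cofactorVec A r id j := fun j => by
    rw [show j = id j from rfl, cofactorVec_apply A r Function.injective_id]
    exact Dvd.dvd.mul_left (delta_dvd_det_submatrix A _ _) _
  choose x hx using hdiv
  refine ⟨x, ⟨l, fun hpl => hd ?_⟩, fun i => ?_⟩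
  · have h1 : (p * Delta A m : ℤ) ∣ cofactorVec A r id l := by
      rw [hx, mul_comm]; exact mul_dvd_mul_left _ hpl
    rw [show l = id l from rfl, cofactorVec_apply A r Function.injective_id,
      (Int.isUnit_iff.2 (neg_one_pow_eq_or ℤ (l : ℕ))).dvd_mul_left] at h1
    have h2 : A.submatrix r c = (A.submatrix r l.succAbove).submatrix id σ := by
      rw [hlσ]; rfl
    rw [h2, Matrix.det_permute']
    exact Dvd.dvd.mul_left h1 _
  · have h1 : (Delta A (m + 1) : ℤ) ∣ ∑ l, A i l * cofactorVec A r id l := by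
      rw [sum_mul_cofactorVec]; exact delta_dvd_det_submatrix A _ _
    have h2 : ∑ l, A i l * cofactorVec A r id l = (∑ l, A i l * x l) * Delta A m := by
      rw [Finset.sum_mul]
      exact Finset.sum_congr rfl fun l _ => by rw [hx l]; ring
    rw [h2, ← deltaRatio_mul] at h1
    push_cast at h1
    exact (mul_dvd_mul_iff_right hΔ).1 h1

/-- There is a primitive integer vector that the matrix annihilates modulo `Δ_m / Δ_{m-1}`. -/
theorem exists_primitive (A : Matrix ι (Fin (m + 1)) ℤ) :
    ∃ d t : Fin (m + 1) → ℤ, ∑ l, d l * t l = 1 ∧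
      ∀ i, (deltaRatio A : ℤ) ∣ ∑ l, A i l * d l := by
  classical
  rcases eq_or_ne (Delta A (m + 1)) 0 with h | h
  · obtain ⟨x, hx, hAx⟩ := exists_ne_zero_of_delta_eq_zero A h
    have hn : deltaRatio A = 0 := by rw [deltaRatio, h, Nat.zero_div]
    exact exists_primitive_of_gcd A x hx (fun p _ _ h => absurd hn h) fun i => by simp [hAx i]
  · have hΔ : Delta A m ≠ 0 := fun h0 => h (by rw [← deltaRatio_mul, h0, mul_zero])
    have hn : deltaRatio A ≠ 0 := fun h0 => h (by rw [← deltaRatio_mul, h0, zero_mul])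
    choose x hx hAx using exists_not_dvd_of_prime A hΔ
    rcases eq_or_ne (deltaRatio A) 1 with h1 | h1
    · refine ⟨Pi.single 0 1, Pi.single 0 1, ?_, fun i => by simp [h1]⟩
      rw [Finset.sum_eq_single 0]
      · simp
      · intro b _ hb; simp [hb]
      · simp
    set S := (deltaRatio A).primeFactors
    have hSp : ∀ p ∈ S, p.Prime := fun p hp => Nat.prime_of_mem_primeFactors hp
    -- Chinese remainder gluing: modulo `p` only the summand of `p` survives, and its coefficient is
    -- invertible.
    let y : Fin (m + 1) → ℤ := fun l =>
      ∑ p ∈ S.attach, (∏ q ∈ S.erase p, (q : ℤ)) * x p (hSp p p.2) l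
    have hy : ∀ p ∈ S, ∃ l, ¬ (p : ℤ) ∣ y l := by
      intro p hp
      obtain ⟨l, hl⟩ := hx p (hSp p hp)
      have hpp : Prime (p : ℤ) := Nat.prime_iff_prime_int.1 (hSp p hp)
      refine ⟨l, fun hdvd => ?_⟩
      have hsplit : y l = (∏ q ∈ S.erase p, (q : ℤ)) * x p (hSp p hp) l +
          ∑ q ∈ S.attach.erase ⟨p, hp⟩, (∏ q' ∈ S.erase q, (q' : ℤ)) * x q (hSp q q.2) l :=
        (Finset.add_sum_erase _ _ (Finset.mem_attach S ⟨p, hp⟩)).symm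
      have hrest : (p : ℤ) ∣ ∑ q ∈ S.attach.erase ⟨p, hp⟩,
          (∏ q' ∈ S.erase q, (q' : ℤ)) * x q (hSp q q.2) l := by
        refine Finset.dvd_sum fun q hq => Dvd.dvd.mul_right ?_ _
        refine Finset.dvd_prod_of_mem (fun q : ℕ => (q : ℤ)) (Finset.mem_erase.2 ⟨?_, hp⟩)
        rintro rfl
        exact (Finset.mem_erase.1 hq).1 rfl
      rw [hsplit, dvd_add_left hrest] at hdvd
      rcases hpp.dvd_or_dvd hdvd with h2 | h2
      · obtain ⟨q, hq, hpq⟩ := (hpp.dvd_finsetProd_iff _).1 h2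
        rw [Finset.mem_erase] at hq
        exact hq.1 ((Nat.prime_dvd_prime_iff_eq (hSp p hp) (hSp q hq.2)).1
          (Int.natCast_dvd_natCast.1 hpq)).symm
      · exact hl h2
    refine exists_primitive_of_gcd A y ?_
      (fun p hp hpn _ => hy p (Nat.mem_primeFactors.2 ⟨hp, hpn, hn⟩)) fun i => ?_
    · intro h0
      obtain ⟨l, hl⟩ := hy _ (Nat.mem_primeFactors.2 ⟨Nat.minFac_prime h1, Nat.minFac_dvd _, hn⟩)
      exact hl (by simp [h0])
    · simp only [y, Finset.mul_sum]
      rw [Finset.sum_comm]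
      refine Finset.dvd_sum fun p _ => ?_
      have h2 := (hAx p (hSp p p.2) i).mul_left (∏ q ∈ S.erase p, (q : ℤ))
      rw [Finset.mul_sum] at h2
      convert h2 using 2
      ring

end Delta

/-! ### Twists of homomorphisms and the counting argument. -/

section Twist

universe u

variable {F G : Type*} [Group F] [Group G]

/-- The composition of a homomorphism with the conjugation by `h`. -/
def conjHom (h : G) (φ : F →* G) : F →* G := (MulAut.conj h).toMonoidHom.comp φ

@[simp]
theorem conjHom_apply (h : G) (φ : F →* G) (f : F) : conjHom h φ f = h * φ f * h⁻¹ := rfl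

theorem conjHom_mul (h k : G) (φ : F →* G) : conjHom (h * k) φ = conjHom h (conjHom k φ) :=
  MonoidHom.ext fun f => by simp [mul_assoc]

theorem conjHom_one (φ : F →* G) : conjHom 1 φ = φ := MonoidHom.ext fun f => by simp

variable (deg : F →* Multiplicative ℤ) (L : Subgroup G)

/-- The largest subgroup of `L` that is normalised by the image of `φ` and centralises the image of
the kernel of `deg`. -/
def core (φ : F →* G) : Subgroup G where
  carrier := {h | ∀ f, φ f * h * (φ f)⁻¹ ∈ L ⊓ Subgroup.centralizer (φ '' deg.ker)}
  one_mem' f := by simp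
  mul_mem' {a b} ha hb f := by
    have := Subgroup.mul_mem _ (ha f) (hb f)
    simpa [mul_assoc] using this
  inv_mem' {a} ha f := by
    have := Subgroup.inv_mem _ (ha f)
    simpa [mul_assoc] using this

variable {deg L}

theorem mem_inf_of_mem_core {φ : F →* G} {h : G} (hh : h ∈ core deg L φ) :
    h ∈ L ⊓ Subgroup.centralizer (φ '' deg.ker) := by simpa using hh 1

theorem mem_of_mem_core {φ : F →* G} {h : G} (hh : h ∈ core deg L φ) : h ∈ L :=
  (mem_inf_of_mem_core hh).1

theorem mul_comm_of_mem_core {φ : F →* G} {h : G} (hh : h ∈ core deg L φ) {f : F}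
    (hf : deg f = 1) : φ f * h = h * φ f :=
  Subgroup.mem_centralizer_iff.1 (mem_inf_of_mem_core hh).2 _ ⟨f, hf, rfl⟩

theorem conj_mem_core {φ : F →* G} {h : G} (hh : h ∈ core deg L φ) (f : F) :
    φ f * h * (φ f)⁻¹ ∈ core deg L φ := fun f' => by
  have := hh (f' * f)
  simpa [mul_assoc] using this

theorem inv_conj_mem_core {φ : F →* G} {h : G} (hh : h ∈ core deg L φ) (f : F) :
    (φ f)⁻¹ * h * φ f ∈ core deg L φ := by simpa using conj_mem_core hh f⁻¹

variable (deg L)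

/-- `ψ` is obtained from `φ` by multiplication by elements of the core of `φ`, without changes on
the kernel of `deg`. -/
def IsTwist (φ ψ : F →* G) : Prop :=
  (∀ f, (φ f)⁻¹ * ψ f ∈ core deg L φ) ∧ ∀ f, deg f = 1 → φ f = ψ f

variable {deg L}

theorem IsTwist.image_ker {φ ψ : F →* G} (h : IsTwist deg L φ ψ) :
    φ '' deg.ker = ψ '' deg.ker :=
  Set.image_congr fun f hf => h.2 f hf

/-- Conjugation by ψ f differs from conjugation by φ f by an inner automorphism of the core, and the
images of the kernel coincide. This is what makes twisting an equivalence relation. -/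
theorem IsTwist.core_eq {φ ψ : F →* G} (h : IsTwist deg L φ ψ) :
    core deg L φ = core deg L ψ := by
  have hle : core deg L φ ≤ core deg L ψ := fun a ha f => by
    have h1 := Subgroup.mul_mem _ (Subgroup.mul_mem _ (h.1 f) ha) (Subgroup.inv_mem _ (h.1 f))
    have h2 := h1 f
    rw [h.image_ker] at h2
    convert h2 using 1
    group
  refine le_antisymm hle fun a ha f => ?_
  have h0 := hle (h.1 f)
  have h1 := Subgroup.mul_mem _ (Subgroup.mul_mem _ (Subgroup.inv_mem _ h0) ha) h0
  have h2 := h1 f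
  rw [← h.image_ker] at h2
  convert h2 using 1
  group

theorem IsTwist.refl (φ : F →* G) : IsTwist deg L φ φ :=
  ⟨fun f => by simp, fun _ _ => rfl⟩

theorem IsTwist.symm {φ ψ : F →* G} (h : IsTwist deg L φ ψ) : IsTwist deg L ψ φ := by
  refine ⟨fun f => ?_, fun f hf => (h.2 f hf).symm⟩
  rw [← h.core_eq]
  simpa using Subgroup.inv_mem _ (h.1 f)

theorem IsTwist.trans {φ ψ χ : F →* G} (h : IsTwist deg L φ ψ) (h' : IsTwist deg L ψ χ) :
    IsTwist deg L φ χ := by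
  refine ⟨fun f => ?_, fun f hf => (h.2 f hf).trans (h'.2 f hf)⟩
  have := Subgroup.mul_mem _ (h.1 f) (h.core_eq ▸ h'.1 f)
  simpa [mul_assoc] using this

theorem conj_mem_core_conjHom {φ : F →* G} {h a : G} (hh : h ∈ L) (ha : a ∈ core deg L φ) :
    h * a * h⁻¹ ∈ core deg L (conjHom h φ) := fun f => by
  have e : conjHom h φ f * (h * a * h⁻¹) * (conjHom h φ f)⁻¹ = h * (φ f * a * (φ f)⁻¹) * h⁻¹ := by
    simp [mul_assoc]
  rw [e]
  refine ⟨L.mul_mem (L.mul_mem hh (ha f).1) (L.inv_mem hh), Subgroup.mem_centralizer_iff.2 ?_⟩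
  rintro _ ⟨k, hk, rfl⟩
  have h1 := Subgroup.mem_centralizer_iff.1 (ha f).2 _ ⟨k, hk, rfl⟩
  calc conjHom h φ k * (h * (φ f * a * (φ f)⁻¹) * h⁻¹)
      = h * (φ k * (φ f * a * (φ f)⁻¹)) * h⁻¹ := by simp [mul_assoc]
    _ = h * ((φ f * a * (φ f)⁻¹) * φ k) * h⁻¹ := by rw [h1]
    _ = _ := by simp [mul_assoc]

theorem IsTwist.conjHom {φ ψ : F →* G} (h : IsTwist deg L φ ψ) {a : G} (ha : a ∈ L) :
    IsTwist deg L (conjHom a φ) (conjHom a ψ) := by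
  refine ⟨fun f => ?_, fun f hf => by simp [h.2 f hf]⟩
  have := conj_mem_core_conjHom ha (h.1 f)
  simpa [mul_assoc] using this

/-- The overlap of the two operations is exactly the core; hence the factor L/U in the size of a
class. -/
theorem isTwist_conjHom_iff {φ : F →* G} {h : G} (hh : h ∈ L) :
    IsTwist deg L φ (conjHom h φ) ↔ h ∈ core deg L φ := by
  constructor
  · intro ht
    have hC : h ∈ L ⊓ Subgroup.centralizer (φ '' deg.ker) := by
      refine ⟨hh, Subgroup.mem_centralizer_iff.2 ?_⟩
      rintro _ ⟨k, hk, rfl⟩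
      have := ht.2 k hk
      rw [conjHom_apply, eq_mul_inv_iff_mul_eq] at this
      exact this
    intro f
    -- The twist condition at f⁻¹ concerns φ(f) h φ(f)⁻¹ h⁻¹; multiplying by `h` gives the required
    -- conjugate.
    have h1 := Subgroup.mul_mem _ (mem_inf_of_mem_core (ht.1 f⁻¹)) hC
    simpa [mul_assoc] using h1
  · intro hc
    refine ⟨fun f => ?_, fun f hf => ?_⟩
    · have := Subgroup.mul_mem _ (inv_conj_mem_core hc f) (Subgroup.inv_mem _ hc)
      simpa [mul_assoc] using this
    · rw [conjHom_apply, ← mul_comm_of_mem_core hc hf, mul_inv_cancel_right]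

theorem zpow_inv_mul_mul_zpow_mem {U : Subgroup G} {v u : G} (hv : ∀ a ∈ U, v * a * v⁻¹ ∈ U)
    (hv' : ∀ a ∈ U, v⁻¹ * a * v ∈ U) (hu : u ∈ U) (z : ℤ) : (v ^ z)⁻¹ * (v * u) ^ z ∈ U := by
  induction z with
  | zero => simp
  | succ z ih =>
    have h1 := U.mul_mem (hv' _ ih) hu
    convert h1 using 1
    rw [zpow_add_one, zpow_add_one]
    group
  | pred z ih =>
    have h1 := hv _ (U.mul_mem ih (U.inv_mem hu))
    convert h1 using 1
    rw [zpow_sub_one, zpow_sub_one]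
    group

theorem eq_of_eq_on_ker {φ ψ : F →* G} {t : F} (ht : deg t = Multiplicative.ofAdd 1)
    (h : ∀ f, deg f = 1 → φ f = ψ f) (h1 : φ t = ψ t) : φ = ψ := by
  refine MonoidHom.ext fun f => ?_
  have hk : deg (f * (t ^ (deg f).toAdd)⁻¹) = 1 := by
    rw [map_mul, map_inv, map_zpow, ht, ← ofAdd_zsmul]; simp
  have h2 := h _ hk
  rw [map_mul, map_mul, map_inv, map_inv, map_zpow, map_zpow, h1] at h2
  exact mul_right_cancel h2

/-- Every element of the core defines a twist. -/
theorem exists_isTwist {t : F} (ht : deg t = Multiplicative.ofAdd 1) (φ : F →* G) {u : G}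
    (hu : u ∈ core deg L φ) : ∃ ψ, IsTwist deg L φ ψ ∧ ψ t = φ t * u := by
  set v := φ t with hv
  set w := v * u with hw
  let D : F → ℤ := fun f => (deg f).toAdd
  have hD : ∀ f g, D (f * g) = D f + D g := fun f g => by simp [D]
  have hmem : ∀ z : ℤ, (v ^ z)⁻¹ * w ^ z ∈ core deg L φ :=
    zpow_inv_mul_mul_zpow_mem (fun a ha => conj_mem_core ha t)
      (fun a ha => inv_conj_mem_core ha t) hu
  have hker : ∀ f, deg (f * (t ^ D f)⁻¹) = 1 := fun f => by
    rw [map_mul, map_inv, map_zpow, ht, ← ofAdd_zsmul]; simp [D]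
  -- Writing f = k t^(D f) with k of degree 0, the product φ f · c f equals φ(k) w^(D f). It is
  -- multiplicative because `c f` lies in the core and so commutes with φ of the kernel.
  let c : F → G := fun f => (v ^ D f)⁻¹ * w ^ D f
  have hmul : ∀ f g, φ (f * g) * c (f * g) = φ f * c f * (φ g * c g) := fun f g => by
    have h1 := mul_comm_of_mem_core (hmem (D f)) (hker g)
    calc φ (f * g) * c (f * g)
        = φ f * φ (g * (t ^ D g)⁻¹) * (v ^ D f)⁻¹ * (w ^ D f) * w ^ D g := by
          simp only [c, hD, zpow_add, map_mul, map_inv, map_zpow, ← hv]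
          simp only [mul_inv_rev, mul_assoc]
      _ = φ f * (φ (g * (t ^ D g)⁻¹) * ((v ^ D f)⁻¹ * w ^ D f)) * w ^ D g := by
          simp only [mul_assoc]
      _ = φ f * (((v ^ D f)⁻¹ * w ^ D f) * φ (g * (t ^ D g)⁻¹)) * w ^ D g := by rw [h1]
      _ = φ f * c f * (φ g * c g) := by
          simp only [c, map_mul, map_inv, map_zpow, ← hv]; group
  refine ⟨MonoidHom.mk' (fun f => φ f * c f) hmul, ⟨fun f => ?_, fun f hf => ?_⟩, ?_⟩
  · simpa using hmem (D f)
  · simp [c, D, hf]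
  · simp [c, D, ht, hw, hv]

/-- A twist of `φ` is conjugate to `φ`, by an element of the core, on the elements whose degree is
divisible by the order of `L`. -/
theorem IsTwist.exists_conj {t : F} (ht : deg t = Multiplicative.ofAdd 1) {φ ψ : F →* G}
    (h : IsTwist deg L φ ψ) {f : F} (hf : (Nat.card L : ℤ) ∣ (deg f).toAdd) :
    ∃ a ∈ L, ψ f = a * φ f * a⁻¹ := by
  set U := core deg L φ
  have hUL : U ≤ L := fun a ha => mem_of_mem_core ha
  obtain ⟨q, hq⟩ := (Int.natCast_dvd_natCast.2 (Subgroup.card_dvd_of_le hUL)).trans hf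
  -- Brauer's lemma conjugates φ(t)^|U| to ψ(t)^|U|. Since |U| divides the degree of `f`, the same
  -- `a` works for the power of `t` in `f`, and it commutes with the kernel part.
  obtain ⟨a, ha, hpow⟩ := exists_mul_pow_card_eq_conj U (φ t) ((φ t)⁻¹ * ψ t)
    (fun a ha => conj_mem_core ha t) (h.1 t)
  rw [mul_inv_cancel_left] at hpow
  have hk : deg (f * (t ^ (deg f).toAdd)⁻¹) = 1 := by
    rw [map_mul, map_inv, map_zpow, ht, ← ofAdd_zsmul]; simp
  have h1 := h.2 _ hk
  have h2 := mul_comm_of_mem_core (Subgroup.inv_mem _ ha) hk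
  have hz : ψ t ^ (deg f).toAdd = a * φ t ^ (deg f).toAdd * a⁻¹ := by
    rw [hq, zpow_mul, zpow_mul, zpow_natCast, zpow_natCast, hpow, conj_zpow]
  refine ⟨a, hUL ha, ?_⟩
  have e1 : ∀ χ : F →* G, χ f = χ (f * (t ^ (deg f).toAdd)⁻¹) * χ t ^ (deg f).toAdd := fun χ => by
    simp
  have h3 : φ (f * (t ^ (deg f).toAdd)⁻¹) * a = a * φ (f * (t ^ (deg f).toAdd)⁻¹) :=
    mul_comm_of_mem_core ha hk
  rw [e1 ψ, e1 φ, ← h1, hz]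
  simp only [← mul_assoc]
  rw [h3]

/-- A set of homomorphisms closed under twists and under conjugation by the elements of `L` has
cardinality divisible by the order of `L`. -/
theorem mk_dvd_mk_of_closed {F G : Type u} [Group F] [Group G] {deg : F →* Multiplicative ℤ}
    {L : Subgroup G} {t : F} (ht : deg t = Multiplicative.ofAdd 1) (Φ : Set (F →* G))
    (hconj : ∀ φ ∈ Φ, ∀ h ∈ L, conjHom h φ ∈ Φ)
    (htwist : ∀ φ ∈ Φ, ∀ ψ, IsTwist deg L φ ψ → ψ ∈ Φ) :
    Cardinal.mk L ∣ Cardinal.mk Φ := by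
  let s : Setoid Φ :=
    { r := fun φ ψ => ∃ h ∈ L, IsTwist deg L (conjHom h φ.1) ψ.1
      iseqv :=
        { refl := fun φ => ⟨1, L.one_mem, by rw [conjHom_one]; exact IsTwist.refl _⟩
          symm := by
            rintro φ ψ ⟨h, hh, H⟩
            refine ⟨h⁻¹, L.inv_mem hh, ?_⟩
            have := (H.conjHom (L.inv_mem hh)).symm
            rwa [← conjHom_mul, inv_mul_cancel, conjHom_one] at this
          trans := by
            rintro φ ψ χ ⟨h, hh, H⟩ ⟨k, hk, K⟩
            refine ⟨k * h, L.mul_mem hk hh, ?_⟩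
            rw [conjHom_mul]
            exact (H.conjHom hk).trans K } }
  have key : ∀ φ : Φ, Cardinal.mk L = Cardinal.mk {ψ : Φ // Quotient.mk s ψ = Quotient.mk s φ} := by
    intro φ
    let U := (core deg L φ.1).subgroupOf L
    choose tw htw htt using fun u : U => exists_isTwist ht φ.1 (Subgroup.mem_subgroupOf.1 u.2)
    -- A pair (coset, u) goes to the twist of φ with value φ(t)u at `t`, conjugated by the coset
    -- representative.
    let B : (L ⧸ U) × U → {ψ : Φ // Quotient.mk s ψ = Quotient.mk s φ} := fun p =>
      ⟨⟨conjHom (p.1.out : G) (tw p.2),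
          hconj _ (htwist _ φ.2 _ (htw p.2)) _ p.1.out.2⟩,
        (Quotient.sound (s := s) ⟨p.1.out, p.1.out.2, (htw p.2).conjHom p.1.out.2⟩).symm⟩
    refine Cardinal.mk_congr
      (Subgroup.groupEquivQuotientProdSubgroup.trans (Equiv.ofBijective B ⟨?_, ?_⟩))
    · rintro ⟨q, u⟩ ⟨q', u'⟩ hB
      have h1 : conjHom (q.out : G) (tw u) = conjHom (q'.out : G) (tw u') :=
        congrArg (fun x => x.1.1) hB
      have h2 : conjHom ((q'.out : G)⁻¹ * q.out) (tw u) = tw u' := by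
        rw [conjHom_mul, h1, ← conjHom_mul, inv_mul_cancel, conjHom_one]
      have hmem : (q'.out : G)⁻¹ * q.out ∈ L := L.mul_mem (L.inv_mem q'.out.2) q.out.2
      have h3 : IsTwist deg L φ.1 (conjHom ((q'.out : G)⁻¹ * q.out) φ.1) := by
        have := ((htw u).conjHom hmem)
        rw [h2] at this
        exact (htw u').trans this.symm
      have h4 : q' = q := by
        rw [← QuotientGroup.out_eq' q', ← QuotientGroup.out_eq' q, QuotientGroup.eq]
        exact Subgroup.mem_subgroupOf.2 ((isTwist_conjHom_iff hmem).1 h3)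
      subst h4
      rw [inv_mul_cancel, conjHom_one] at h2
      have h5 := htt u
      rw [h2, htt u'] at h5
      exact Prod.ext rfl (Subtype.ext (Subtype.ext (mul_left_cancel h5)).symm)
    · rintro ⟨ψ, hψ⟩
      obtain ⟨h, hh, H⟩ : ∃ h ∈ L, IsTwist deg L (conjHom h φ.1) ψ.1 := Quotient.exact hψ.symm
      let q : L ⧸ U := QuotientGroup.mk ⟨h, hh⟩
      -- Replacing `h` by the chosen representative `h * c` costs only a twist, as `c` is in the
      -- core.
      obtain ⟨c, hc⟩ := QuotientGroup.mk_out_eq_mul U ⟨h, hh⟩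
      have hq : (q.out : G) = h * c.1 := congrArg Subtype.val hc
      have hcU : ((c.1 : L) : G)⁻¹ ∈ core deg L φ.1 :=
        Subgroup.inv_mem _ (Subgroup.mem_subgroupOf.1 c.2)
      have h1 : IsTwist deg L φ.1 (conjHom (q.out : G)⁻¹ ψ.1) := by
        have h2 := H.conjHom (L.inv_mem q.out.2)
        rw [← conjHom_mul, hq, mul_inv_rev, inv_mul_cancel_right] at h2
        rw [hq, mul_inv_rev]
        exact ((isTwist_conjHom_iff (mem_of_mem_core hcU)).2 hcU).trans h2
      let u : U := ⟨⟨_, mem_of_mem_core (h1.1 t)⟩, Subgroup.mem_subgroupOf.2 (h1.1 t)⟩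
      refine ⟨(q, u), Subtype.ext (Subtype.ext ?_)⟩
      have h2 : tw u = conjHom (q.out : G)⁻¹ ψ.1 := by
        refine eq_of_eq_on_ker ht (fun f hf => ((htw u).2 f hf).symm.trans (h1.2 f hf)) ?_
        rw [htt u, mul_inv_cancel_left]
      change conjHom (q.out : G) (tw u) = ψ.1
      rw [h2, ← conjHom_mul, mul_inv_cancel, conjHom_one]
  rw [← Cardinal.mk_congr (Equiv.sigmaFiberEquiv (Quotient.mk s)), Cardinal.mk_sigma]
  have hconst : (fun q : Quotient s => Cardinal.mk {ψ : Φ // Quotient.mk s ψ = q}) =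
      fun _ => Cardinal.mk L := by
    funext q
    induction q using Quotient.inductionOn with
    | h φ => exact (key φ).symm
  rw [hconst, Cardinal.sum_const']
  exact dvd_mul_left _ _

end Twist

/-! ### Solutions as homomorphisms from a free product. -/

section Solutions

variable {G : Type*} [Group G] {m : ℕ}

theorem expSum_mul (j : Fin m) (u v : Monoid.Coprod G (FreeGroup (Fin m))) :
    expSum j (u * v) = expSum j u + expSum j v := by
  simp only [expSum, map_mul, toAdd_mul]

theorem expSum_inl (j : Fin m) (a : G) : expSum j (Monoid.Coprod.inl a) = 0 := by
  simp [expSum]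

theorem expSum_inr_of (j k : Fin m) :
    expSum j (Monoid.Coprod.inr (FreeGroup.of k) : Monoid.Coprod G (FreeGroup (Fin m))) =
      if k = j then 1 else 0 := by
  simp [expSum]

/-- The degree on the free product for which the unknowns have prescribed degrees and the elements
of `G` have degree zero. -/
def weightedDegree (G : Type*) [Group G] (d : Fin m → ℤ) :
    Monoid.Coprod G (FreeGroup (Fin m)) →* Multiplicative ℤ :=
  MonoidHom.mk' (fun u => Multiplicative.ofAdd (∑ l, expSum l u * d l)) fun u v => by
    rw [← ofAdd_add, ← Finset.sum_add_distrib]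
    simp only [expSum_mul, add_mul]

theorem toAdd_weightedDegree (d : Fin m → ℤ) (u : Monoid.Coprod G (FreeGroup (Fin m))) :
    (weightedDegree G d u).toAdd = ∑ l, expSum l u * d l := rfl

theorem weightedDegree_inl (d : Fin m → ℤ) (a : G) :
    weightedDegree G d (Monoid.Coprod.inl a) = 1 := by
  apply Multiplicative.toAdd.injective
  simp [toAdd_weightedDegree, expSum_inl]

theorem weightedDegree_inr_of (d : Fin m → ℤ) (k : Fin m) :
    weightedDegree G d (Monoid.Coprod.inr (FreeGroup.of k)) = Multiplicative.ofAdd (d k) := by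
  apply Multiplicative.toAdd.injective
  simp [toAdd_weightedDegree, expSum_inr_of]

/-- The inclusion of `K * F(x₁, …, x_m)` into `G * F(x₁, …, x_m)` for a subgroup `K` of `G`. -/
def inclCoprod (K : Subgroup G) (m : ℕ) :
    Monoid.Coprod K (FreeGroup (Fin m)) →* Monoid.Coprod G (FreeGroup (Fin m)) :=
  Monoid.Coprod.map K.subtype (MonoidHom.id _)

/-- Allows G to be replaced by the centraliser of L as the coefficient group, so that conjugation by
L fixes all coefficients. -/
theorem toCoprod_mem_range_inclCoprod (K : Subgroup G) (w : Word G m) (hw : w.coeffs ⊆ K) :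
    w.toCoprod ∈ (inclCoprod K m).range := by
  refine Subgroup.list_prod_mem _ fun y hy => ?_
  obtain ⟨x, hx, rfl⟩ := List.mem_map.1 hy
  rcases x with a | ⟨j, b⟩
  · exact ⟨Monoid.Coprod.inl ⟨a, hw hx⟩, by simp [inclCoprod, letter]⟩
  · cases b
    · exact ⟨Monoid.Coprod.inr (FreeGroup.of j)⁻¹, by simp [inclCoprod, letter]⟩
    · exact ⟨Monoid.Coprod.inr (FreeGroup.of j), by simp [inclCoprod, letter]⟩

theorem mul_mul_mem_doubleCoset {H : Subgroup G} {g h x : G} (hh : h ∈ H)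
    (hx : x ∈ DoubleCoset.doubleCoset g (H : Set G) H) (k : G) (hk : k ∈ H) :
    h * x * k ∈ DoubleCoset.doubleCoset g (H : Set G) H := by
  obtain ⟨a, ha, b, hb, rfl⟩ := DoubleCoset.mem_doubleCoset.1 hx
  exact DoubleCoset.mem_doubleCoset.2
    ⟨h * a, H.mul_mem hh ha, b * k, H.mul_mem hb hk, by simp only [mul_assoc]⟩

/-- A subgroup of `H̃` whose order divides the degrees of the left-hand sides of the subsystem, for
some primitive choice of the degrees of the unknowns, has order dividing the number of solutions. -/
theorem mk_dvd_mk_solutions {I : Type*} (w : I → Word G m) (g : I → G) (H : I → Subgroup G)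
    (J : Set I) (L : Subgroup G) (hL : L ≤ tildeH w g H J) (d t : Fin m → ℤ)
    (hdt : ∑ l, d l * t l = 1)
    (hd : ∀ j ∈ J, (Nat.card L : ℤ) ∣ ∑ l, expSum l (w j).toCoprod * d l) :
    Cardinal.mk L ∣ Cardinal.mk (solutions w g H) := by
  set K := Subgroup.centralizer (L : Set G)
  let ι := inclCoprod K m
  let deg : Monoid.Coprod K (FreeGroup (Fin m)) →* Multiplicative ℤ := (weightedDegree G d).comp ι
  let ev : (Fin m → G) → (Monoid.Coprod K (FreeGroup (Fin m)) →* G) := fun x => (evalAt x).comp ι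
  have ev_inl : ∀ x (a : K), ev x (Monoid.Coprod.inl a) = a := fun x a => by
    simp [ev, ι, inclCoprod, evalAt]
  have ev_inr : ∀ x (k : Fin m), ev x (Monoid.Coprod.inr (FreeGroup.of k)) = x k := fun x k => by
    simp [ev, ι, inclCoprod, evalAt]
  have deg_inl : ∀ a : K, deg (Monoid.Coprod.inl a) = 1 := fun a => by
    simp [deg, ι, inclCoprod, weightedDegree_inl]
  have deg_inr : ∀ k, deg (Monoid.Coprod.inr (FreeGroup.of k)) = Multiplicative.ofAdd (d k) :=
    fun k => by simp [deg, ι, inclCoprod, weightedDegree_inr_of]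
  have ev_eq : ∀ φ : Monoid.Coprod K (FreeGroup (Fin m)) →* G,
      (∀ a : K, φ (Monoid.Coprod.inl a) = a) →
        ev (fun k => φ (Monoid.Coprod.inr (FreeGroup.of k))) = φ := fun φ hφ => by
    refine Monoid.Coprod.hom_ext (MonoidHom.ext fun a => ?_) (FreeGroup.ext_hom _ _ fun k => ?_)
    · simp [ev_inl, hφ]
    · simp [ev_inr]
  have hword : ∀ i, ∃ W, ι W = (w i).toCoprod := fun i => by
    refine toCoprod_mem_range_inclCoprod K (w i) fun a ha => ?_
    refine Subgroup.mem_centralizer_iff.2 fun h hh => ?_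
    exact (Subgroup.mem_centralizer_iff.1 (hL hh).2 a (Set.mem_iUnion.2 ⟨i, ha⟩)).symm
  choose W hW using hword
  have hevW : ∀ x i, ev x (W i) = evalAt x (w i).toCoprod := fun x i => by
    rw [← hW]; rfl
  -- Primitivity of `d` is used here: the product of the x_l^(t_l) has degree ∑ d_l t_l = 1.
  obtain ⟨τ, hτ⟩ : ∃ τ, deg τ = Multiplicative.ofAdd 1 := by
    have h1 : Multiplicative.ofAdd (∑ l, d l * t l) ∈ deg.range := by
      rw [ofAdd_sum]
      refine Subgroup.prod_mem _ fun l _ => ⟨Monoid.Coprod.inr (FreeGroup.of l) ^ t l, ?_⟩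
      rw [map_zpow, deg_inr, ← ofAdd_zsmul, smul_eq_mul, mul_comm]
    rwa [hdt] at h1
  have hnorm : ∀ h ∈ L, ∀ j ∈ J, ∀ x,
      x ∈ DoubleCoset.doubleCoset (g j) (H j : Set G) (H j) →
        h * x * h⁻¹ ∈ DoubleCoset.doubleCoset (g j) (H j : Set G) (H j) := fun h hh j hj x hx => by
    have h1 := (hL hh).1.1
    have h2 := Subgroup.mem_iInf.1 (Subgroup.mem_iInf.1 h1 j) hj
    exact (h2 x).1 hx
  have hmemH : ∀ h ∈ L, ∀ i ∉ J, h ∈ H i := fun h hh i hi =>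
    Subgroup.mem_iInf.1 (Subgroup.mem_iInf.1 (hL hh).1.2 i) hi
  have hcomm : ∀ h ∈ L, ∀ a : K, h * a = a * h := fun h hh a =>
    Subgroup.mem_centralizer_iff.1 a.2 h hh
  have hinj : Function.Injective ev := fun x y hxy => by
    funext k; rw [← ev_inr x, ← ev_inr y, hxy]
  have hmk : Cardinal.mk (ev '' solutions w g H) = Cardinal.mk (solutions w g H) :=
    Cardinal.mk_image_eq hinj
  rw [← hmk]
  refine mk_dvd_mk_of_closed hτ _ ?_ ?_
  · rintro _ ⟨x, hx, rfl⟩ h hh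
    have hfix : ∀ a : K, conjHom h (ev x) (Monoid.Coprod.inl a) = a := fun a => by
      rw [conjHom_apply, ev_inl, hcomm h hh, mul_inv_cancel_right]
    refine ⟨_, fun i => ?_, ev_eq _ hfix⟩
    rw [← hevW, ev_eq _ hfix, conjHom_apply, hevW]
    by_cases hi : i ∈ J
    · exact hnorm h hh i hi _ (hx i)
    · have := hmemH h hh i hi
      exact mul_mul_mem_doubleCoset this (hx i) _ ((H i).inv_mem this)
  · rintro _ ⟨x, hx, rfl⟩ ψ hψ
    have hfix : ∀ a : K, ψ (Monoid.Coprod.inl a) = a := fun a => by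
      rw [← hψ.2 _ (deg_inl a), ev_inl]
    refine ⟨_, fun i => ?_, ev_eq _ hfix⟩
    rw [← hevW, ev_eq _ hfix]
    by_cases hi : i ∈ J
    · obtain ⟨a, ha, hconj⟩ := hψ.exists_conj hτ (f := W i) (by
        simpa only [deg, MonoidHom.comp_apply, hW, toAdd_weightedDegree] using hd i hi)
      rw [hconj, hevW]
      exact hnorm a ha i hi _ (hx i)
    · have h1 := hmemH _ (mem_of_mem_core (hψ.1 (W i))) i hi
      have h2 := mul_mul_mem_doubleCoset (H i).one_mem (hx i) _ h1
      rwa [hevW, one_mul, mul_inv_cancel_left] at h2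

end Solutions

end GroupEquations

/-! ### The divisibility theorem. -/

theorem theorem2 {G : Type*} [Group G] {m : ℕ} {I : Type*}
    (w : I → GroupEquations.Word G m) (g : I → G) (H : I → Subgroup G) (J : Set I) :
    GroupEquations.groupGCD (GroupEquations.tildeH w g H J)
        (GroupEquations.deltaRatio (GroupEquations.systemMatrix fun j : J => w j)) ∣
      Cardinal.mk (GroupEquations.solutions w g H) := by
  refine GroupEquations.groupGCD_dvd fun L hL => ?_
  -- For m = 0 the truncated m - 1 is 0, so the ratio is Δ_0/Δ_0 = 1 and |L| divides 1.
  rcases m with _ | m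
  · rw [GroupEquations.deltaRatio, GroupEquations.delta_zero, Nat.div_one, Nat.cast_one] at hL
    exact hL.trans (one_dvd _)
  obtain ⟨d, t, hdt, hd⟩ :=
    GroupEquations.exists_primitive (GroupEquations.systemMatrix fun j : J => w j)
  have hcard : Cardinal.mk (L.map (Subgroup.subtype _)) = Cardinal.mk L :=
    (Cardinal.mk_congr (L.equivMapOfInjective _ (Subgroup.subtype_injective _)).toEquiv).symm
  rw [← hcard] at hL ⊢
  refine GroupEquations.mk_dvd_mk_solutions w g H J _ (Subgroup.map_subtype_le L) d t hdt
    fun j hj => ?_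
  refine Dvd.dvd.trans ?_ (hd ⟨j, hj⟩)
  -- `Cardinal.toNat` sends an infinite |L| to 0, in accordance with `Nat.card`; the divisibility
  -- then forces the ratio to be 0.
  have h1 := map_dvd Cardinal.toNat hL
  rw [Cardinal.toNat_natCast] at h1
  exact Int.natCast_dvd_natCast.2 h1
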